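/- Let $(\Omega,\mu)$ be a Borel probability space, i.e. a standard Borel space with a probability measure; write $L^p=L^p(\Omega,\mu;\mathbb R)$. A P-operator is a bounded linear operator $A:L^\infty\to L^1$; for $p,q\in[1,\infty]$ put $\|A\|_{p\to q}=\sup_{0\ne f\in L^\infty}\|Af\|_q/\|f\|_p\in[0,\infty]$ and $(f,g)_A=\int_\Omega (Af)\,g\,d\mu$ for $f,g\in L^\infty$. A graphop is a P-operator such that $(f,g)_A=(g,f)_A$ for all $f,g\in L^\infty$ and $Af\ge 0$ a.e. whenever $f\ge 0$ a.e. A bofop is a graphop with $\|A\|_{1\to1}<\infty$. A measurable family of measures is a family $(\nu_x)_{x\in\Omega}$ of measures on $\Omega$ such that $x\mapsto\nu_x(E)$ is measurable for every measurable $E\subset\Omega$. A signal is a measurable function $f:\Omega\to[-1,1]$. 1. Let $A$ be a graphop. There is a unique finite measure $\nu$ on $\Omega\times\Omega$ that is symmetric ($\nu(S\times T)=\nu(T\times S)$ for all measurable $S,T$), has both marginals absolutely continuous with respect to $\mu$, and satisfies $(f,g)_A=\int f(x)g(y)\,d\nu(x,y)$ for all $f,g\in L^\infty$. It has a disintegration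 along the second coordinate, i.e. a measurable family of measures $(\nu_x)_{x\in\Omega}$ on $\Omega$ with $\nu(E)=\int_\Omega\nu_x(\{y:(y,x)\in E\})\,d\mu(x)$ for all measurable $E\subset\Omega\times\Omega$; this family is unique up to equality for $\mu$-a.e. $x$. For every $f\in L^\infty$, $(Af)(x)=\int_\Omega f\,d\nu_x$ for a.e. $x$ (in particular $f$ is $\nu_x$-integrable for a.e. $x$). The operator $A$ is bounded from $L^\infty$ to $L^\infty$ (that is, $\|A\|_{\infty\to\infty}<\infty$) if and only if $\operatorname{ess\,sup}_{x}\nu_x(\Omega)<\infty$, and in $[0,\infty]$ $$\|A\|_{\infty\to\infty}=\|A\|_{1\to1}=\operatorname*{ess\,sup}_{x\in\Omega}\nu_x(\Omega).$$ 2. Let $A$ be a bofop. There is a measurable family of measures $(\nu_x)_{x\in\Omega}$ on $\Omega$, unique up to equality for $\mu$-a.e. $x$, such that for every signal $f$, for a.e. $x$, $f$ is $\nu_x$-integrable and $(Af)(x)=\int_\Omega f\,d\nu_x$. The same formula then holds for every $f\in L^\infty$, and $$\|A\|_{\infty\to\infty}=\|A\|_{1\to1}=\operatorname*{ess\,sup}_{x\in\Omega}\nu_x(\Omega)<\infty.$$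 3. Conversely, let $(\nu_x)_{x\in\Omega}$ be a measurable family of measures on $\Omega$ with $\operatorname{ess\,sup}_x\nu_x(\Omega)<\infty$ such that $f\mapsto(x\mapsto\int f\,d\nu_x)$ is symmetric, i.e. $\int_\Omega\left(\int u\,d\nu_x\right)v(x)\,d\mu(x)=\int_\Omega\left(\int v\,d\nu_x\right)u(x)\,d\mu(x)$ for all signals $u,v$. Then there is exactly one P-operator $A$ with $(Af)(x)=\int_\Omega f\,d\nu_x$ for a.e. $x$, for every $f\in L^\infty$ (already the formula for signals $f$ determines $A$); it is a bofop, and $\|A\|_{\infty\to\infty}=\|A\|_{1\to1}=\operatorname{ess\,sup}_x\nu_x(\Omega)$. -/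

import Mathlib

open MeasureTheory ProbabilityTheory
open scoped ENNReal

noncomputable section

namespace Bofop

variable {Ω : Type*} [MeasurableSpace Ω]

/-- A P-operator: a bounded linear operator `L^∞(Ω) → L^1(Ω)`. -/
abbrev POperator (μ : Measure Ω) : Type _ := Lp ℝ ∞ μ →L[ℝ] Lp ℝ 1 μ

/-- The norm `‖A‖_{p → q} = sup { ‖A f‖_q / ‖f‖_p : f ∈ L^∞(Ω), f ≠ 0 }`, with values in
`[0, ∞]`. -/
def opNorm {μ : Measure Ω} (p q : ℝ≥0∞) (A : POperator μ) : ℝ≥0∞ :=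
  ⨆ (f : Lp ℝ ∞ μ) (_ : f ≠ 0), eLpNorm (A f) q μ / eLpNorm f p μ

/-- The bilinear form `(v, u)_A = ∫ (A v) u dμ`. -/
def form {μ : Measure Ω} (A : POperator μ) (v u : Lp ℝ ∞ μ) : ℝ :=
  ∫ x, A v x * u x ∂μ

/-- `A` is self adjoint: `(v, u)_A = (u, v)_A` for all `u, v ∈ L^∞(Ω)`. -/
def SelfAdjoint {μ : Measure Ω} (A : POperator μ) : Prop :=
  ∀ v u : Lp ℝ ∞ μ, form A v u = form A u v

/-- `A` is positively preserving. -/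
def PositivelyPreserving {μ : Measure Ω} (A : POperator μ) : Prop :=
  ∀ v : Lp ℝ ∞ μ, (∀ᵐ x ∂μ, 0 ≤ v x) → ∀ᵐ x ∂μ, 0 ≤ A v x

/-- A graphop: a self adjoint and positively preserving P-operator. -/
structure IsGraphop {μ : Measure Ω} (A : POperator μ) : Prop where
  selfAdjoint : SelfAdjoint A
  positive : PositivelyPreserving A

/-- A bounded fiber operator (bofop): a graphop with finite `1 → 1` norm. -/
structure IsBofop {μ : Measure Ω} (A : POperator μ) : Prop extends IsGraphop A where
  norm_lt_top : opNorm 1 1 A < ∞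

/-- A (one-channel) signal: a measurable function `Ω → [-1, 1]`. -/
structure IsSignal (f : Ω → ℝ) : Prop where
  measurable : Measurable f
  mem_Icc : ∀ x, f x ∈ Set.Icc (-1 : ℝ) 1

/-- The formula `(A f)(x) = ∫ f dν_x`, for almost every `x`, including the fact that the
integral exists. -/
def FiberFormula {μ : Measure Ω} (A : POperator μ) (ν : Kernel Ω Ω) (f : Ω → ℝ)
    (hf : MemLp f ∞ μ) : Prop :=
  ∀ᵐ x ∂μ, Integrable f (ν x) ∧ A (hf.toLp f) x = ∫ y, f y ∂(ν x)

/-- The fiber formula holds for every signal. A `Kernel Ω Ω` is a measurable family `(ν_x)` of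
measures on `Ω`, that is, `x ↦ ν_x(E)` is measurable for every measurable `E`. -/
def ActsOnSignals {μ : Measure Ω} (A : POperator μ) (ν : Kernel Ω Ω) : Prop :=
  ∀ (f : Ω → ℝ) (hf : MemLp f ∞ μ), IsSignal f → FiberFormula A ν f hf

/-- The fiber formula holds for every `f ∈ L^∞(Ω)` and every representative of `f`. -/
def ActsOnLinfty {μ : Measure Ω} (A : POperator μ) (ν : Kernel Ω Ω) : Prop :=
  ∀ (f : Ω → ℝ) (hf : MemLp f ∞ μ), FiberFormula A ν f hf

/-- The essential supremum of the total masses `ν_x(Ω)`. -/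
def fiberBound (μ : Measure Ω) (ν : Kernel Ω Ω) : ℝ≥0∞ :=
  essSup (fun x => ν x Set.univ) μ

/-- The operator `u ↦ (x ↦ ∫ u dν_x)` is symmetric. -/
def SymmetricFibers (μ : Measure Ω) (ν : Kernel Ω Ω) : Prop :=
  ∀ u v : Ω → ℝ, IsSignal u → IsSignal v →
    ∫ x, (∫ y, u y ∂(ν x)) * v x ∂μ = ∫ x, (∫ y, v y ∂(ν x)) * u x ∂μ

/-- `N` is a representing measure of `A` on `Ω × Ω`: a finite symmetric measure with marginals
absolutely continuous with respect to `μ` such that `(f, g)_A = ∫ f(x) g(y) dN(x, y)`. -/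
structure IsRepresentingMeasure {μ : Measure Ω} (A : POperator μ) (N : Measure (Ω × Ω)) :
    Prop where
  finite : IsFiniteMeasure N
  symmetric : ∀ S T : Set Ω, MeasurableSet S → MeasurableSet T → N (S ×ˢ T) = N (T ×ˢ S)
  fst_ac : N.map Prod.fst ≪ μ
  snd_ac : N.map Prod.snd ≪ μ
  form_eq : ∀ f g : Lp ℝ ∞ μ, form A f g = ∫ z, f z.1 * g z.2 ∂N

/-- `(ν_x)` is the disintegration of `N` with respect to `μ` along the second projection,
where the fiber over `x` is identified with `Ω`. -/
def IsDisintegration (μ : Measure Ω) (N : Measure (Ω × Ω)) (ν : Kernel Ω Ω) : Prop :=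
  ∀ E : Set (Ω × Ω), MeasurableSet E → N E = ∫⁻ x, ν x {y | (y, x) ∈ E} ∂μ

end Bofop

end

/-! Symmetry supplies the countable additivity that a bounded map from `L^∞` to `L^1` lacks: since
`∫_T A 1_S = ∫_S A 1_T`, monotone convergence of `S` forces convergence of `A 1_S`. The fibers
should satisfy `ν_x(S) = (A 1_S)(x)`, with a null set depending on `S`. To make one choice for all
`S`, embed `Ω` in the line: off a null set, `q ↦ A 1_{e ≤ q} / A 1` is a distribution function on
the rationals wherever `A 1 > 0`. Its Stieltjes measure, weighted by `A 1` and pulled back to `Ω`,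
is `ν_x`.

Everything else runs through `IsFiberKernel`: `∫_T ν_x dμ` has density `A 1_T`. Being an identity of
measures, it can be integrated against any bounded `f`, which yields `A f = ∫ f dν_x` by
self-adjointness. With `T = Ω` it says that the density of `∫ ν_x dμ` is `ν_x(Ω)` itself, so the row
and column masses agree and both norms equal the essential supremum. The representing measure is `μ
⊗ₘ ν` with its factors exchanged. For the converse, symmetry tested on `1_S` and `1` shows that `∫
ν_x dμ` charges no `μ`-null set, so integration against the fibers descends to `L^∞`. -/

namespace Bofop

open Set Filter Topology

variable {Ω : Type*} [MeasurableSpace Ω] {μ : Measure Ω}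

/-! ### Symmetry and monotone continuity of `A` on indicators. -/

section Indicator

variable [IsProbabilityMeasure μ] {A : POperator μ} {S T : Set Ω}

/-- The indicator function of a measurable set, as an element of `L^∞`. -/
noncomputable def ind (μ : Measure Ω) [IsProbabilityMeasure μ] {S : Set Ω}
    (hS : MeasurableSet S) : Lp ℝ ∞ μ :=
  indicatorConstLp ∞ hS (measure_ne_top μ S) 1

theorem ind_ae_eq (hS : MeasurableSet S) : ind μ hS =ᵐ[μ] S.indicator fun _ => (1 : ℝ) :=
  indicatorConstLp_coeFn

omit [IsProbabilityMeasure μ] in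
theorem integrable_apply (A : POperator μ) (f : Lp ℝ ∞ μ) : Integrable (A f) μ :=
  L1.integrable_coeFn _

theorem form_ind (f : Lp ℝ ∞ μ) (hT : MeasurableSet T) :
    form A f (ind μ hT) = ∫ x in T, A f x ∂μ := by
  rw [form, ← integral_indicator hT]
  refine integral_congr_ae ?_
  filter_upwards [ind_ae_eq (μ := μ) hT] with x hx
  rw [hx]
  by_cases h : x ∈ T <;> simp [h]

theorem IsGraphop.setIntegral_comm (hA : IsGraphop A) (hS : MeasurableSet S)
    (hT : MeasurableSet T) :
    ∫ x in T, A (ind μ hS) x ∂μ = ∫ x in S, A (ind μ hT) x ∂μ := by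
  rw [← form_ind, ← form_ind, hA.selfAdjoint]

theorem IsGraphop.ind_nonneg (hA : IsGraphop A) (hS : MeasurableSet S) :
    ∀ᵐ x ∂μ, 0 ≤ A (ind μ hS) x := by
  refine hA.positive _ ?_
  filter_upwards [ind_ae_eq (μ := μ) hS] with x hx
  rw [hx]
  exact indicator_nonneg (fun _ _ => zero_le_one) x

theorem IsGraphop.ind_mono (hA : IsGraphop A) (hS : MeasurableSet S) (hT : MeasurableSet T)
    (h : S ⊆ T) : ∀ᵐ x ∂μ, A (ind μ hS) x ≤ A (ind μ hT) x := by
  have h1 : ∀ᵐ x ∂μ, 0 ≤ A (ind μ hT - ind μ hS) x := by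
    refine hA.positive _ ?_
    filter_upwards [ind_ae_eq (μ := μ) hS, ind_ae_eq (μ := μ) hT,
      Lp.coeFn_sub (ind μ hT) (ind μ hS)] with x hx hx' hs
    rw [hs, Pi.sub_apply, hx, hx', sub_nonneg]
    exact indicator_le_indicator_of_subset h (fun _ => zero_le_one) x
  rw [map_sub] at h1
  filter_upwards [h1, Lp.coeFn_sub (A (ind μ hT)) (A (ind μ hS))] with x hx hs
  rw [hs, Pi.sub_apply] at hx
  linarith

theorem IsGraphop.ind_empty (hA : IsGraphop A) :
    ∀ᵐ x ∂μ, A (ind μ MeasurableSet.empty) x = 0 := by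
  have h : (∫ x, A (ind μ MeasurableSet.empty) x ∂μ) = 0 := by
    have := hA.setIntegral_comm MeasurableSet.empty MeasurableSet.univ
    simpa using this
  exact (integral_eq_zero_iff_of_nonneg_ae (hA.ind_nonneg _) (integrable_apply _ _)).1 h

/-- By symmetry `∫ A 1_{S n} = ∫_{S n} A 1`, which converges by continuity of the integral in the
set. A monotone sequence lying below its candidate limit and converging to it in integral converges
to it almost everywhere. -/
theorem IsGraphop.tendsto_ind_of_monotone (hA : IsGraphop A) {S : ℕ → Set Ω}
    (hS : ∀ n, MeasurableSet (S n)) (hT : MeasurableSet T) (hm : Monotone S)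
    (hST : ⋃ n, S n = T) :
    ∀ᵐ x ∂μ, Tendsto (fun n => A (ind μ (hS n)) x) atTop (𝓝 (A (ind μ hT) x)) := by
  subst hST
  refine tendsto_of_integral_tendsto_of_monotone (fun n => integrable_apply _ _)
    (integrable_apply _ _) ?_ ?_ ?_
  · have h := tendsto_setIntegral_of_monotone (μ := μ) hS hm
      (integrable_apply A (ind μ MeasurableSet.univ)).integrableOn
    rw [← hA.setIntegral_comm hT MeasurableSet.univ] at h
    simp_rw [← hA.setIntegral_comm (hS _) MeasurableSet.univ] at h
    simpa using h
  · have : ∀ᵐ x ∂μ, ∀ n m, n ≤ m → A (ind μ (hS n)) x ≤ A (ind μ (hS m)) x := by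
      simp_rw [ae_all_iff]
      exact fun n m h => hA.ind_mono _ _ (hm h)
    filter_upwards [this] with x hx n m h using hx n m h
  · exact ae_all_iff.2 fun n => hA.ind_mono _ _ (subset_iUnion S n)

theorem IsGraphop.tendsto_ind_of_antitone (hA : IsGraphop A) {S : ℕ → Set Ω}
    (hS : ∀ n, MeasurableSet (S n)) (hT : MeasurableSet T) (hm : Antitone S)
    (hST : ⋂ n, S n = T) :
    ∀ᵐ x ∂μ, Tendsto (fun n => A (ind μ (hS n)) x) atTop (𝓝 (A (ind μ hT) x)) := by
  subst hST
  refine tendsto_of_integral_tendsto_of_antitone (fun n => integrable_apply _ _)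
    (integrable_apply _ _) ?_ ?_ ?_
  · have h := tendsto_setIntegral_of_antitone (μ := μ) hS hm
      ⟨0, (integrable_apply A (ind μ MeasurableSet.univ)).integrableOn⟩
    rw [← hA.setIntegral_comm hT MeasurableSet.univ] at h
    simp_rw [← hA.setIntegral_comm (hS _) MeasurableSet.univ] at h
    simpa using h
  · have : ∀ᵐ x ∂μ, ∀ n m, n ≤ m → A (ind μ (hS m)) x ≤ A (ind μ (hS n)) x := by
      simp_rw [ae_all_iff]
      exact fun n m h => hA.ind_mono _ _ (hm h)
    filter_upwards [this] with x hx n m h using hx n m h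
  · exact ae_all_iff.2 fun n => hA.ind_mono _ _ (iInter_subset S n)

end Indicator

/-! ### Distribution functions of the fibers. -/

section Construction

variable [IsProbabilityMeasure μ] {A : POperator μ}

/-- The function `q ↦ A 1_{e ≤ q} / A 1` from which the fibers are constructed. -/
noncomputable def ratCDF (A : POperator μ) {e : Ω → ℝ} (he : Measurable e) (x : Ω) (q : ℚ) : ℝ :=
  A (ind μ (he (measurableSet_Iic (a := (q : ℝ))))) x / A (ind μ MeasurableSet.univ) x

theorem measurable_ratCDF (A : POperator μ) {e : Ω → ℝ} (he : Measurable e) :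
    Measurable (ratCDF A he) := by
  refine measurable_pi_iff.2 fun q => ?_
  exact (Lp.stronglyMeasurable _).measurable.div (Lp.stronglyMeasurable _).measurable

theorem IsGraphop.isRatStieltjesPoint (hA : IsGraphop A) {e : Ω → ℝ} (he : Measurable e) :
    ∀ᵐ x ∂μ, 0 < A (ind μ MeasurableSet.univ) x → IsRatStieltjesPoint (ratCDF A he) x := by
  have hmono : ∀ᵐ x ∂μ, ∀ q r : ℚ, q ≤ r →
      A (ind μ (he (measurableSet_Iic (a := (q : ℝ))))) x
        ≤ A (ind μ (he (measurableSet_Iic (a := (r : ℝ))))) x := by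
    simp_rw [ae_all_iff]
    exact fun q r h => hA.ind_mono _ _ (preimage_mono (Iic_subset_Iic.2 (by exact_mod_cast h)))
  have htop := hA.tendsto_ind_of_monotone (T := univ)
    (S := fun n : ℕ => e ⁻¹' Iic (((n : ℚ) : ℚ) : ℝ)) (fun n => he measurableSet_Iic)
    MeasurableSet.univ
    (fun n m h => preimage_mono (Iic_subset_Iic.2 (by exact_mod_cast h)))
    (by
      refine eq_univ_of_forall fun x => mem_iUnion.2 ?_
      obtain ⟨n, hn⟩ := exists_nat_ge (e x)
      exact ⟨n, by simpa using hn⟩)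
  have hbot := hA.tendsto_ind_of_antitone (T := ∅)
    (S := fun n : ℕ => e ⁻¹' Iic ((-(n : ℚ) : ℚ) : ℝ)) (fun n => he measurableSet_Iic)
    MeasurableSet.empty
    (fun n m h => preimage_mono (Iic_subset_Iic.2 (by
      push_cast; exact neg_le_neg (by exact_mod_cast h))))
    (by
      refine eq_empty_of_forall_notMem fun x hx => ?_
      obtain ⟨n, hn⟩ := exists_nat_gt (-e x)
      have := mem_iInter.1 hx n
      simp only [mem_preimage, mem_Iic, Rat.cast_neg, Rat.cast_natCast] at this
      linarith)
  have hright : ∀ᵐ x ∂μ, ∀ q : ℚ, Tendsto (fun n : ℕ =>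
      A (ind μ (he (measurableSet_Iic (a := ((q + 1 / ((n : ℚ) + 1) : ℚ) : ℝ))))) x) atTop
      (𝓝 (A (ind μ (he (measurableSet_Iic (a := (q : ℝ))))) x)) := by
    refine ae_all_iff.2 fun q => hA.tendsto_ind_of_antitone
      (S := fun n : ℕ => e ⁻¹' Iic ((q + 1 / ((n : ℚ) + 1) : ℚ) : ℝ))
      (fun n => he measurableSet_Iic) _ ?_ ?_
    · intro n m h
      refine preimage_mono (Iic_subset_Iic.2 ?_)
      have : q + 1 / ((m : ℚ) + 1) ≤ q + 1 / ((n : ℚ) + 1) := by gcongr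
      exact_mod_cast this
    · ext x
      simp only [mem_iInter, mem_preimage, mem_Iic]
      constructor
      · intro h
        refine le_of_forall_pos_le_add fun ε hε => ?_
        obtain ⟨n, hn⟩ := exists_nat_one_div_lt hε
        have := h n
        push_cast at this
        linarith
      · intro h n
        push_cast
        have : (0 : ℝ) < 1 / ((n : ℝ) + 1) := by positivity
        linarith
  filter_upwards [hmono, htop, hbot, hright, hA.ind_empty] with x hmono htop hbot hright hempty hpos
  have hm : Monotone (ratCDF A he x) := fun q r h =>
    div_le_div_of_nonneg_right (hmono q r h) hpos.le
  rw [hempty] at hbot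
  refine ⟨hm, ?_, ?_, fun t => ?_⟩
  · refine (tendsto_iff_tendsto_subseq_of_monotone hm tendsto_natCast_atTop_atTop).2 ?_
    have := htop.div_const (A (ind μ MeasurableSet.univ) x)
    rwa [div_self hpos.ne'] at this
  · have hanti : Antitone fun q : ℚ => ratCDF A he x (-q) := fun q r h => hm (neg_le_neg h)
    have h := hbot.div_const (A (ind μ MeasurableSet.univ) x)
    rw [zero_div] at h
    have h' := ((tendsto_iff_tendsto_subseq_of_antitone hanti
      (tendsto_natCast_atTop_atTop (R := ℚ))).2 h).comp tendsto_neg_atBot_atTop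
    simpa [Function.comp_def] using h'
  · have hlim := (hright t).div_const (A (ind μ MeasurableSet.univ) x)
    -- Right continuity: the infimum over `r > t` is bounded above by the values at `t + 1/(n+1)`,
    -- which tend to the value at `t`.
    have hbdd : BddBelow (range fun r : Ioi t => ratCDF A he x r) :=
      ⟨ratCDF A he x t, by rintro _ ⟨r, rfl⟩; exact hm (le_of_lt r.2)⟩
    refine le_antisymm (ge_of_tendsto' hlim fun n => ?_) ?_
    · exact ciInf_le hbdd ⟨t + 1 / ((n : ℚ) + 1), by
        rw [mem_Ioi]; have : (0 : ℚ) < 1 / ((n : ℚ) + 1) := by positivity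
        linarith⟩
    · exact le_ciInf fun r => hm (le_of_lt r.2)

end Construction

/-! ### The fiber kernel, on the line and then on `Ω`. -/

variable [IsProbabilityMeasure μ] {A : POperator μ}

/-- `(ν_x)` are the fibers of `A`: the measures `∫_T ν_x dμ(x)` have density `A 1_T`. -/
def IsFiberKernel (A : POperator μ) (ν : Kernel Ω Ω) : Prop :=
  ∀ (T : Set Ω) (hT : MeasurableSet T),
    (μ.restrict T).bind ν = μ.withDensity fun x => ENNReal.ofReal (A (ind μ hT) x)

theorem IsGraphop.setLIntegral_comm (hA : IsGraphop A) {S T : Set Ω} (hS : MeasurableSet S)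
    (hT : MeasurableSet T) :
    ∫⁻ x in T, ENNReal.ofReal (A (ind μ hS) x) ∂μ
      = ∫⁻ x in S, ENNReal.ofReal (A (ind μ hT) x) ∂μ := by
  rw [← ofReal_integral_eq_lintegral_ofReal (integrable_apply _ _).integrableOn
      (ae_restrict_of_ae (hA.ind_nonneg hS)),
    ← ofReal_integral_eq_lintegral_ofReal (integrable_apply _ _).integrableOn
      (ae_restrict_of_ae (hA.ind_nonneg hT)), hA.setIntegral_comm hS hT]

theorem IsGraphop.isFiberKernel_of_ae_eq (hA : IsGraphop A) {ν : Kernel Ω Ω}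
    (h : ∀ S (hS : MeasurableSet S), ∀ᵐ x ∂μ, ν x S = ENNReal.ofReal (A (ind μ hS) x)) :
    IsFiberKernel A ν := by
  intro T hT
  ext S hS
  rw [Measure.bind_apply hS ν.aemeasurable, withDensity_apply _ hS, ← hA.setLIntegral_comm hS hT]
  exact lintegral_congr_ae (ae_restrict_of_ae (h S hS))

instance isFiniteMeasure_withDensity_apply (A : POperator μ) (f : Lp ℝ ∞ μ) :
    IsFiniteMeasure (μ.withDensity fun x => ENNReal.ofReal (A f x)) :=
  isFiniteMeasure_withDensity_ofReal (integrable_apply A f).2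

theorem IsFiberKernel.ae_apply (hA : IsGraphop A) {ν : Kernel Ω Ω} (h : IsFiberKernel A ν)
    {S : Set Ω} (hS : MeasurableSet S) :
    ∀ᵐ x ∂μ, ν x S = ENNReal.ofReal (A (ind μ hS) x) := by
  refine ae_eq_of_forall_setLIntegral_eq_of_sigmaFinite (ν.measurable_coe hS)
    (Lp.stronglyMeasurable _).measurable.ennreal_ofReal fun T hT _ => ?_
  rw [hA.setLIntegral_comm hS hT, ← withDensity_apply _ hS, ← h T hT,
    Measure.bind_apply hS ν.aemeasurable]

/-- The kernel on the real line obtained from an embedding of the space into the line. -/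
noncomputable def realKernel (A : POperator μ) {e : Ω → ℝ} (he : Measurable e) : Kernel Ω ℝ where
  toFun x := ENNReal.ofReal (A (ind μ MeasurableSet.univ) x) •
    (stieltjesOfMeasurableRat _ (measurable_ratCDF A he) x).measure
  measurable' := by
    refine Measure.measurable_of_measurable_coe _ fun s hs => ?_
    simp only [Measure.smul_apply, smul_eq_mul]
    exact (Lp.stronglyMeasurable _).measurable.ennreal_ofReal.mul
      ((Measure.measurable_coe hs).comp (measurable_measure_stieltjesOfMeasurableRat _))

theorem realKernel_apply (A : POperator μ) {e : Ω → ℝ} (he : Measurable e) (x : Ω) :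
    realKernel A he x = ENNReal.ofReal (A (ind μ MeasurableSet.univ) x) •
      (stieltjesOfMeasurableRat _ (measurable_ratCDF A he) x).measure := rfl

theorem IsGraphop.realKernel_Iic (hA : IsGraphop A) {e : Ω → ℝ} (he : Measurable e) (q : ℚ) :
    ∀ᵐ x ∂μ, realKernel A he x (Iic (q : ℝ))
      = ENNReal.ofReal (A (ind μ (he (measurableSet_Iic (a := (q : ℝ))))) x) := by
  filter_upwards [hA.isRatStieltjesPoint he, hA.ind_nonneg MeasurableSet.univ,
    hA.ind_nonneg (he (measurableSet_Iic (a := (q : ℝ)))),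
    hA.ind_mono (he (measurableSet_Iic (a := (q : ℝ)))) MeasurableSet.univ (subset_univ _)]
    with x hx h0 h1 h2
  rw [realKernel_apply, Measure.smul_apply, measure_stieltjesOfMeasurableRat_Iic,
    stieltjesOfMeasurableRat_eq, smul_eq_mul]
  rcases h0.eq_or_lt with h | h
  -- Where `A 1` vanishes, so does `A 1_{e ≤ q}` by monotonicity; the zero weight makes the choice
  -- of Stieltjes function there irrelevant.
  · rw [← h] at h2 ⊢
    rw [le_antisymm h2 h1]
    simp
  · rw [toRatCDF_of_isRatStieltjesPoint (hx h), ← ENNReal.ofReal_mul h0, ratCDF,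
      mul_div_cancel₀ _ h.ne']

theorem realKernel_univ (A : POperator μ) {e : Ω → ℝ} (he : Measurable e) (x : Ω) :
    realKernel A he x univ = ENNReal.ofReal (A (ind μ MeasurableSet.univ) x) := by
  rw [realKernel_apply, Measure.smul_apply, measure_stieltjesOfMeasurableRat_univ, smul_eq_mul,
    mul_one]

theorem IsGraphop.bind_realKernel (hA : IsGraphop A) {e : Ω → ℝ} (he : Measurable e)
    {T : Set Ω} (hT : MeasurableSet T) :
    (μ.restrict T).bind (realKernel A he)
      = (μ.withDensity fun x => ENNReal.ofReal (A (ind μ hT) x)).map e := by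
  -- The uniqueness theorem for measures on a π-system wants its first measure finite, which is
  -- known for the side with a density.
  symm
  have key : ∀ B (hB : MeasurableSet B), (∀ᵐ x ∂μ, realKernel A he x B
      = ENNReal.ofReal (A (ind μ (he hB)) x)) →
      (μ.withDensity fun x => ENNReal.ofReal (A (ind μ hT) x)).map e B
        = (μ.restrict T).bind (realKernel A he) B := by
    intro B hB h
    rw [Measure.map_apply he hB, withDensity_apply _ (he hB), ← hA.setLIntegral_comm (he hB) hT,
      Measure.bind_apply hB (Kernel.aemeasurable _)]
    exact (lintegral_congr_ae (ae_restrict_of_ae h)).symm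
  refine ext_of_generate_finite _ Real.borel_eq_generateFrom_Iic_rat Real.isPiSystem_Iic_rat ?_ ?_
  · intro s hs
    obtain ⟨q, rfl⟩ := mem_iUnion.1 hs
    exact key _ measurableSet_Iic (hA.realKernel_Iic he q)
  · exact key _ MeasurableSet.univ (ae_of_all _ (realKernel_univ A he))

/-- The fibers of a graphop. -/
noncomputable def fiberKernel [StandardBorelSpace Ω] (A : POperator μ) : Kernel Ω Ω :=
  (realKernel A (measurable_embeddingReal Ω)).comapRight (measurableEmbedding_embeddingReal Ω)

theorem fiberKernel_apply_lt_top [StandardBorelSpace Ω] (A : POperator μ) (x : Ω) :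
    fiberKernel A x univ < ∞ := by
  rw [fiberKernel, Kernel.comapRight_apply' _ _ _ MeasurableSet.univ]
  refine (measure_mono (subset_univ _)).trans_lt ?_
  rw [realKernel_univ]
  exact ENNReal.ofReal_lt_top

/-- Pulling back along the embedding loses no mass: the averaged real kernel is a pushforward under
that embedding, hence concentrated on its range. -/
theorem IsGraphop.isFiberKernel_fiberKernel [StandardBorelSpace Ω] (hA : IsGraphop A) :
    IsFiberKernel A (fiberKernel A) := by
  intro T hT
  have he := measurableEmbedding_embeddingReal Ω
  ext S hS
  rw [Measure.bind_apply hS (Kernel.aemeasurable _)]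
  simp_rw [fiberKernel, Kernel.comapRight_apply' _ _ _ hS]
  rw [← Measure.bind_apply (he.measurableSet_image.2 hS) (Kernel.aemeasurable _),
    hA.bind_realKernel _ hT, he.map_apply, preimage_image_eq _ he.injective]

omit [IsProbabilityMeasure μ] in
/-- Two measurable families of measures, one of which is finite, agree almost everywhere if they
agree almost everywhere on every measurable set. -/
theorem ae_eq_of_forall_measurableSet [StandardBorelSpace Ω] {ν ν' : Kernel Ω Ω}
    (hfin : ∀ᵐ x ∂μ, ν x univ < ∞)
    (h : ∀ S, MeasurableSet S → ∀ᵐ x ∂μ, ν' x S = ν x S) : ∀ᵐ x ∂μ, ν' x = ν x := by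
  have he := measurableEmbedding_embeddingReal Ω
  -- Rational half-lines form a countable generating π-system, so a single null set suffices.
  have hq : ∀ᵐ x ∂μ, ∀ q : ℚ, ν' x (embeddingReal Ω ⁻¹' Iic (q : ℝ))
      = ν x (embeddingReal Ω ⁻¹' Iic (q : ℝ)) :=
    ae_all_iff.2 fun q => h _ (he.measurable measurableSet_Iic)
  filter_upwards [hfin, h univ MeasurableSet.univ, hq] with x hfin hu hq
  have : IsFiniteMeasure (ν x) := ⟨hfin⟩
  have hmap : (ν x).map (embeddingReal Ω) = (ν' x).map (embeddingReal Ω) := by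
    refine ext_of_generate_finite _ Real.borel_eq_generateFrom_Iic_rat
      Real.isPiSystem_Iic_rat ?_ ?_
    · intro s hs
      obtain ⟨q, rfl⟩ := mem_iUnion.1 hs
      rw [Measure.map_apply he.measurable measurableSet_Iic,
        Measure.map_apply he.measurable measurableSet_Iic, hq]
    · rw [Measure.map_apply he.measurable MeasurableSet.univ,
        Measure.map_apply he.measurable MeasurableSet.univ, preimage_univ, hu]
  ext S _
  rw [← preimage_image_eq S he.injective, ← he.map_apply, ← he.map_apply, hmap]

/-! ### The integral formula. -/

variable {ν : Kernel Ω Ω}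

theorem memLp_top_of_absolutelyContinuous {α : Type*} [MeasurableSpace α] {m m' : Measure α}
    {f : α → ℝ} (hf : MemLp f ∞ m) (h : m' ≪ m) : MemLp f ∞ m' :=
  ⟨hf.1.mono_ac h, by
    have := hf.2
    rw [eLpNorm_exponent_top] at this ⊢
    exact (eLpNormEssSup_mono_measure f h).trans_lt this⟩

theorem IsFiberKernel.bind_eq (h : IsFiberKernel A ν) :
    μ.bind ν = μ.withDensity fun x => ENNReal.ofReal (A (ind μ MeasurableSet.univ) x) := by
  have := h univ MeasurableSet.univ
  rwa [Measure.restrict_univ] at this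

theorem IsFiberKernel.bind_ac (h : IsFiberKernel A ν) : μ.bind ν ≪ μ := by
  rw [h.bind_eq]
  exact withDensity_absolutelyContinuous _ _

theorem IsFiberKernel.isFiniteMeasure_bind (h : IsFiberKernel A ν) :
    IsFiniteMeasure (μ.bind ν) := by
  rw [h.bind_eq]
  infer_instance

theorem IsFiberKernel.integrable_bind (h : IsFiberKernel A ν) {f : Ω → ℝ} (hf : MemLp f ∞ μ) :
    Integrable f (μ.bind ν) := by
  have := h.isFiniteMeasure_bind
  exact (memLp_top_of_absolutelyContinuous hf h.bind_ac).integrable le_top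

theorem integral_bind {m : Measure Ω} {f : Ω → ℝ} (hf : Integrable f (m.bind ν)) :
    ∫ y, f y ∂(m.bind ν) = ∫ x, ∫ y, f y ∂(ν x) ∂m := by
  rw [Measure.comp_eq_comp_const_apply] at hf ⊢
  rw [Kernel.integral_comp hf, Kernel.const_apply]

theorem integrable_integral_of_bind {m : Measure Ω} {f : Ω → ℝ} (hf : Integrable f (m.bind ν)) :
    Integrable (fun x => ∫ y, f y ∂(ν x)) m := by
  rw [Measure.comp_eq_comp_const_apply] at hf
  simpa using hf.integral_comp

/-- Compare integrals over `T`: `∫_T ∫ f dν_x dμ = ∫ f · A 1_T dμ = ∫_T A f dμ`, by the density of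
the averaged fibers and self-adjointness. No approximation of `f` is needed. -/
theorem IsFiberKernel.actsOnLinfty (h : IsFiberKernel A ν) (hA : IsGraphop A) :
    ActsOnLinfty A ν := by
  intro f hf
  have hfi := h.integrable_bind hf
  have key : A (hf.toLp f) =ᵐ[μ] fun x => ∫ y, f y ∂(ν x) := by
    refine Integrable.ae_eq_of_forall_setIntegral_eq _ _ (integrable_apply _ _)
      (integrable_integral_of_bind hfi) fun T hT _ => ?_
    have hT' : Integrable f ((μ.restrict T).bind ν) := by
      have : (μ.restrict T).bind ν ≪ μ := by
        rw [h T hT]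
        exact withDensity_absolutelyContinuous _ _
      have : IsFiniteMeasure ((μ.restrict T).bind ν) := by
        rw [h T hT]
        infer_instance
      exact (memLp_top_of_absolutelyContinuous hf ‹_›).integrable le_top
    rw [← integral_bind hT', h T hT, integral_withDensity_eq_integral_toReal_smul
      (Lp.stronglyMeasurable _).measurable.ennreal_ofReal (ae_of_all _ fun _ => ENNReal.ofReal_lt_top),
      ← form_ind, hA.selfAdjoint, form]
    refine integral_congr_ae ?_
    filter_upwards [hf.coeFn_toLp, hA.ind_nonneg hT] with x hx h0
    rw [hx, ENNReal.toReal_ofReal h0, smul_eq_mul]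
  filter_upwards [Measure.ae_integrable_of_integrable_comp hfi, key] with x h1 h2 using ⟨h1, h2⟩

omit [IsProbabilityMeasure μ] in
theorem ActsOnLinfty.actsOnSignals (h : ActsOnLinfty A ν) : ActsOnSignals A ν :=
  fun f hf _ => h f hf

theorem isSignal_indicator {S : Set Ω} (hS : MeasurableSet S) :
    IsSignal (S.indicator fun _ => (1 : ℝ)) where
  measurable := measurable_const.indicator hS
  mem_Icc x := by by_cases h : x ∈ S <;> simp [h]

theorem memLp_indicator {S : Set Ω} (hS : MeasurableSet S) :
    MemLp (S.indicator fun _ => (1 : ℝ)) ∞ μ :=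
  memLp_indicator_const _ hS _ (Or.inr (measure_ne_top μ S))

theorem ActsOnSignals.ae_apply (h : ActsOnSignals A ν) {S : Set Ω} (hS : MeasurableSet S) :
    ∀ᵐ x ∂μ, ν x S = ENNReal.ofReal (A (ind μ hS) x) := by
  have hind : (memLp_indicator (μ := μ) hS).toLp _ = ind μ hS := rfl
  filter_upwards [h _ (memLp_indicator hS) (isSignal_indicator hS)] with x hx
  obtain ⟨h1, h2⟩ := hx
  rw [hind, integral_indicator_const _ hS, smul_eq_mul, mul_one] at h2
  -- Integrability forces `ν x S < ∞`; without it the Bochner integral would return `0` and hide an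
  -- infinite mass.
  rw [integrable_indicator_iff hS, integrableOn_const_iff] at h1
  rw [h2, Measure.real, ENNReal.ofReal_toReal]
  exact (h1.resolve_left (by simp)).ne

theorem ActsOnSignals.isFiberKernel (h : ActsOnSignals A ν) (hA : IsGraphop A) :
    IsFiberKernel A ν :=
  hA.isFiberKernel_of_ae_eq fun _ hS => h.ae_apply hS

/-! ### The two norms. -/

theorem IsFiberKernel.fiberBound_eq (h : IsFiberKernel A ν) (hA : IsGraphop A) :
    fiberBound μ ν = eLpNorm (A (ind μ MeasurableSet.univ)) ∞ μ := by
  rw [eLpNorm_exponent_top, eLpNormEssSup, fiberBound]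
  refine essSup_congr_ae ?_
  filter_upwards [h.ae_apply hA MeasurableSet.univ, hA.ind_nonneg MeasurableSet.univ]
    with x hx h0
  rw [hx, Real.enorm_of_nonneg h0]

theorem IsFiberKernel.enorm_apply_le (h : IsFiberKernel A ν) (hA : IsGraphop A) (f : Lp ℝ ∞ μ) :
    ∀ᵐ x ∂μ, ‖A f x‖ₑ ≤ ∫⁻ y, ‖f y‖ₑ ∂(ν x) := by
  filter_upwards [h.actsOnLinfty hA f (Lp.memLp f)] with x hx
  rw [Lp.toLp_coeFn] at hx
  rw [hx.2]
  exact enorm_integral_le_lintegral_enorm _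

omit [IsProbabilityMeasure μ] in
theorem opNorm_le {p q C : ℝ≥0∞} (hC : ∀ f : Lp ℝ ∞ μ, eLpNorm (A f) q μ ≤ C * eLpNorm f p μ) :
    opNorm p q A ≤ C :=
  iSup₂_le fun f _ => ENNReal.div_le_of_le_mul (hC f)

omit [IsProbabilityMeasure μ] in
theorem le_opNorm (p q : ℝ≥0∞) {f : Lp ℝ ∞ μ} (hf : f ≠ 0) :
    eLpNorm (A f) q μ / eLpNorm f p μ ≤ opNorm p q A :=
  le_iSup₂_of_le f hf le_rfl

theorem eLpNorm_ind {S : Set Ω} (hS : MeasurableSet S) : eLpNorm (ind μ hS) 1 μ = μ S := by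
  rw [eLpNorm_congr_ae (ind_ae_eq hS), eLpNorm_indicator_const hS one_ne_zero ENNReal.one_ne_top]
  simp

theorem ind_ne_zero {S : Set Ω} (hS : MeasurableSet S) (h : μ S ≠ 0) : ind μ hS ≠ 0 := by
  intro h0
  apply h
  rw [← eLpNorm_ind hS, h0, eLpNorm_congr_ae (Lp.coeFn_zero _ _ _), eLpNorm_zero]

theorem IsFiberKernel.opNorm_top_eq (h : IsFiberKernel A ν) (hA : IsGraphop A) :
    opNorm ∞ ∞ A = fiberBound μ ν := by
  refine le_antisymm (opNorm_le fun f => ?_) ?_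
  · rw [eLpNorm_exponent_top, eLpNorm_exponent_top]
    refine essSup_le_of_ae_le _ ?_
    have hf : ∀ᵐ x ∂μ, ∀ᵐ y ∂(ν x), ‖f y‖ₑ ≤ eLpNormEssSup f μ :=
      Measure.ae_ae_of_ae_comp (h.bind_ac.ae_le (ae_le_eLpNormEssSup (f := f)))
    filter_upwards [h.enorm_apply_le hA f, hf, ENNReal.ae_le_essSup (μ := μ) fun x => ν x univ]
      with x hx hfx hb
    calc ‖A f x‖ₑ ≤ ∫⁻ y, ‖f y‖ₑ ∂(ν x) := hx
      _ ≤ ∫⁻ _, eLpNormEssSup f μ ∂(ν x) := lintegral_mono_ae hfx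
      _ = eLpNormEssSup f μ * ν x univ := lintegral_const _
      _ ≤ fiberBound μ ν * eLpNormEssSup f μ := by rw [mul_comm]; gcongr; exact hb
  -- The constant `1` attains the supremum.
  · have h1 : eLpNorm (ind μ MeasurableSet.univ) ∞ μ = 1 := by
      rw [eLpNorm_congr_ae (ind_ae_eq _), indicator_univ, eLpNorm_const _ (by simp)
        (NeZero.ne μ)]
      simp
    have := le_opNorm (A := A) ∞ ∞ (ind_ne_zero (μ := μ) MeasurableSet.univ (by simp))
    rwa [h1, div_one, ← h.fiberBound_eq hA] at this

theorem IsFiberKernel.opNorm_one_eq (h : IsFiberKernel A ν) (hA : IsGraphop A) :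
    opNorm 1 1 A = fiberBound μ ν := by
  refine le_antisymm (opNorm_le fun f => ?_) ?_
  · rw [eLpNorm_one_eq_lintegral_enorm, eLpNorm_one_eq_lintegral_enorm]
    have hf : Measurable fun x => ‖f x‖ₑ := (Lp.stronglyMeasurable f).measurable.enorm
    calc ∫⁻ x, ‖A f x‖ₑ ∂μ ≤ ∫⁻ x, ∫⁻ y, ‖f y‖ₑ ∂(ν x) ∂μ :=
          lintegral_mono_ae (h.enorm_apply_le hA f)
      _ = ∫⁻ y, ‖f y‖ₑ ∂(μ.bind ν) :=
          (Measure.lintegral_bind ν.aemeasurable hf.aemeasurable).symm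
      _ = ∫⁻ x, ENNReal.ofReal (A (ind μ MeasurableSet.univ) x) * ‖f x‖ₑ ∂μ := by
          rw [h.bind_eq, lintegral_withDensity_eq_lintegral_mul _
            (Lp.stronglyMeasurable _).measurable.ennreal_ofReal hf]
          rfl
      _ ≤ ∫⁻ x, fiberBound μ ν * ‖f x‖ₑ ∂μ := by
          refine lintegral_mono_ae ?_
          filter_upwards [h.ae_apply hA MeasurableSet.univ,
            ENNReal.ae_le_essSup (μ := μ) fun x => ν x univ] with x hx hb
          rw [← hx]
          gcongr
          exact hb
      _ = fiberBound μ ν * ∫⁻ x, ‖f x‖ₑ ∂μ := lintegral_const_mul _ hf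
  -- The essential supremum may be infinite or not attained, so test with the indicator of `{ν_x(Ω)
  -- > d}` for `d` below it. This set has positive measure, and `∫ A 1_T = ∫_T ν_x(Ω) ≥ d μ(T)`.
  · refine le_of_forall_lt fun c hc => ?_
    obtain ⟨d, hcd, hd⟩ := exists_between hc
    refine hcd.trans_le ?_
    let T : Set Ω := {x | d < ν x univ}
    have hT : MeasurableSet T := measurableSet_lt measurable_const
      (ν.measurable_coe MeasurableSet.univ)
    have hT0 : μ T ≠ 0 := by
      intro h0
      refine hd.not_ge (essSup_le_of_ae_le _ ?_)
      filter_upwards [measure_eq_zero_iff_ae_notMem.1 h0] with x hx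
      exact not_lt.1 hx
    refine le_trans ?_ (le_opNorm (A := A) 1 1 (ind_ne_zero hT hT0))
    rw [eLpNorm_ind, ENNReal.le_div_iff_mul_le (Or.inl hT0) (Or.inl (measure_ne_top μ T)),
      eLpNorm_one_eq_lintegral_enorm]
    calc d * μ T = ∫⁻ _ in T, d ∂μ := (setLIntegral_const _ _).symm
      _ ≤ ∫⁻ x in T, ν x univ ∂μ := setLIntegral_mono' hT fun x hx => le_of_lt hx
      _ = (μ.restrict T).bind ν univ :=
          (Measure.bind_apply MeasurableSet.univ ν.aemeasurable).symm
      _ = ∫⁻ x, ENNReal.ofReal (A (ind μ hT) x) ∂μ := by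
          rw [h T hT, withDensity_apply _ MeasurableSet.univ, Measure.restrict_univ]
      _ ≤ ∫⁻ x, ‖A (ind μ hT) x‖ₑ ∂μ := lintegral_mono fun x => Real.ofReal_le_enorm _

/-! ### Representing measure and disintegration. -/

theorem IsRepresentingMeasure.real_prod {N : Measure (Ω × Ω)} (hN : IsRepresentingMeasure A N)
    {S T : Set Ω} (hS : MeasurableSet S) (hT : MeasurableSet T) :
    N.real (S ×ˢ T) = form A (ind μ hS) (ind μ hT) := by
  -- Absolute continuity of the marginals makes the value independent of the chosen representatives.
  have h1 : ∀ᵐ z ∂N, ind μ hS z.1 = S.indicator (fun _ => (1 : ℝ)) z.1 :=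
    ae_of_ae_map measurable_fst.aemeasurable (hN.fst_ac.ae_le (ind_ae_eq hS))
  have h2 : ∀ᵐ z ∂N, ind μ hT z.2 = T.indicator (fun _ => (1 : ℝ)) z.2 :=
    ae_of_ae_map measurable_snd.aemeasurable (hN.snd_ac.ae_le (ind_ae_eq hT))
  rw [hN.form_eq, ← integral_indicator_one (hS.prod hT)]
  refine integral_congr_ae ?_
  filter_upwards [h1, h2] with z h1 h2
  rw [h1, h2]
  by_cases hz1 : z.1 ∈ S <;> by_cases hz2 : z.2 ∈ T <;> simp [indicator, hz1, hz2]

theorem IsRepresentingMeasure.unique {N N' : Measure (Ω × Ω)} (hN : IsRepresentingMeasure A N)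
    (hN' : IsRepresentingMeasure A N') : N' = N := by
  have := hN.finite
  have := hN'.finite
  refine Measure.ext_prod fun {S T} hS hT => ?_
  rw [← measureReal_eq_measureReal_iff, hN.real_prod hS hT, hN'.real_prod hS hT]

/-- The joint measure of the fibers, with the fibers in the first coordinate. -/
noncomputable def jointMeasure (μ : Measure Ω) (ν : Kernel Ω Ω) : Measure (Ω × Ω) :=
  (μ ⊗ₘ ν).map Prod.swap

theorem isDisintegration_jointMeasure [IsSFiniteKernel ν] :
    IsDisintegration μ (jointMeasure μ ν) ν := by
  intro E hE
  rw [jointMeasure, Measure.map_apply measurable_swap hE,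
    Measure.compProd_apply (measurable_swap hE)]
  rfl

omit [IsProbabilityMeasure μ] in
theorem IsDisintegration.apply_prod {N : Measure (Ω × Ω)} (h : IsDisintegration μ N ν)
    {S T : Set Ω} (hS : MeasurableSet S) (hT : MeasurableSet T) :
    N (S ×ˢ T) = ∫⁻ x in T, ν x S ∂μ := by
  rw [h _ (hS.prod hT), ← lintegral_indicator hT]
  refine lintegral_congr fun x => ?_
  by_cases hx : x ∈ T <;> simp [hx]

theorem IsDisintegration.unique [StandardBorelSpace Ω] {N : Measure (Ω × Ω)}
    {ν' : Kernel Ω Ω} (hfin : ∀ᵐ x ∂μ, ν x univ < ∞) (h : IsDisintegration μ N ν)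
    (h' : IsDisintegration μ N ν') : ∀ᵐ x ∂μ, ν' x = ν x := by
  refine ae_eq_of_forall_measurableSet hfin fun S hS => ?_
  refine ae_eq_of_forall_setLIntegral_eq_of_sigmaFinite (ν'.measurable_coe hS)
    (ν.measurable_coe hS) fun T hT _ => ?_
  rw [← h.apply_prod hS hT, ← h'.apply_prod hS hT]

theorem IsFiberKernel.isRepresentingMeasure [IsSFiniteKernel ν] (h : IsFiberKernel A ν)
    (hA : IsGraphop A) : IsRepresentingMeasure A (jointMeasure μ ν) := by
  have hdis : IsDisintegration μ (jointMeasure μ ν) ν := isDisintegration_jointMeasure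
  have hrect : ∀ {S T : Set Ω} (hS : MeasurableSet S) (_ : MeasurableSet T),
      jointMeasure μ ν (S ×ˢ T) = ∫⁻ x in T, ENNReal.ofReal (A (ind μ hS) x) ∂μ := by
    intro S T hS hT
    rw [hdis.apply_prod hS hT]
    exact lintegral_congr_ae (ae_restrict_of_ae (h.ae_apply hA hS))
  have hfin : IsFiniteMeasure (μ ⊗ₘ ν) := by
    have := h.isFiniteMeasure_bind
    constructor
    have h1 := measure_lt_top (μ.bind ν) univ
    rw [Measure.bind_apply MeasurableSet.univ ν.aemeasurable] at h1
    rw [Measure.compProd_apply MeasurableSet.univ]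
    exact h1
  have hfst : (μ ⊗ₘ ν).map Prod.fst ≪ μ := by
    refine Measure.AbsolutelyContinuous.mk fun S hS h0 => ?_
    rw [Measure.map_apply measurable_fst hS, ← prod_univ,
      Measure.compProd_apply_prod hS MeasurableSet.univ]
    exact setLIntegral_measure_zero _ _ h0
  have hsnd : (μ ⊗ₘ ν).map Prod.snd ≪ μ := by
    have := Measure.snd_compProd μ ν
    rw [Measure.snd] at this
    rw [this]
    exact h.bind_ac
  refine ⟨?_, ?_, ?_, ?_, ?_⟩
  · rw [jointMeasure]
    infer_instance
  · intro S T hS hT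
    rw [hrect hS hT, hrect hT hS, hA.setLIntegral_comm hS hT]
  · rw [jointMeasure, Measure.map_map measurable_fst measurable_swap]
    exact hsnd
  · rw [jointMeasure, Measure.map_map measurable_snd measurable_swap]
    exact hfst
  · intro f g
    have hf : MemLp (fun z : Ω × Ω => f z.2) ∞ (μ ⊗ₘ ν) :=
      (memLp_top_of_absolutelyContinuous (Lp.memLp f) hsnd).comp_of_map
        measurable_snd.aemeasurable
    have hg : MemLp (fun z : Ω × Ω => g z.1) ∞ (μ ⊗ₘ ν) :=
      (memLp_top_of_absolutelyContinuous (Lp.memLp g) hfst).comp_of_map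
        measurable_fst.aemeasurable
    have hfg : Integrable (fun z : Ω × Ω => f z.2 * g z.1) (μ ⊗ₘ ν) :=
      (MemLp.mul (r := ∞) hg hf).integrable le_top
    have hswap : ∫ z, f z.1 * g z.2 ∂(jointMeasure μ ν)
        = ∫ z : Ω × Ω, f z.2 * g z.1 ∂(μ ⊗ₘ ν) :=
      integral_map_equiv MeasurableEquiv.prodComm fun z => f z.1 * g z.2
    rw [hswap, Measure.integral_compProd hfg, form]
    refine integral_congr_ae ?_
    filter_upwards [h.actsOnLinfty hA f (Lp.memLp f)] with x hx
    rw [Lp.toLp_coeFn] at hx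
    rw [hx.2, integral_mul_const]

/-- The masses `A 1` are finite but possibly unbounded, so the kernel need not be finite; it is a
Markov kernel with a finite-valued density. This is what `μ ⊗ₘ ν` requires. -/
instance isSFiniteKernel_realKernel (A : POperator μ) {e : Ω → ℝ} (he : Measurable e) :
    IsSFiniteKernel (realKernel A he) := by
  let κ : Kernel Ω ℝ := ⟨fun x => (stieltjesOfMeasurableRat _ (measurable_ratCDF A he) x).measure,
    measurable_measure_stieltjesOfMeasurableRat _⟩
  have : IsMarkovKernel κ := ⟨fun x => instIsProbabilityMeasure_stieltjesOfMeasurableRat _ x⟩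
  have hκ : realKernel A he
      = κ.withDensity fun x _ => ((A (ind μ MeasurableSet.univ) x).toNNReal : ℝ≥0∞) := by
    ext x : 1
    rw [Kernel.withDensity_apply, withDensity_const]
    · rfl
    · exact ((Lp.stronglyMeasurable _).measurable.comp measurable_fst).real_toNNReal.coe_nnreal_ennreal
  rw [hκ]
  infer_instance

instance isSFiniteKernel_fiberKernel [StandardBorelSpace Ω] (A : POperator μ) :
    IsSFiniteKernel (fiberKernel A) :=
  Kernel.IsSFiniteKernel.comapRight _ (measurableEmbedding_embeddingReal Ω)

/-! ### Reduction to signals, and the converse. -/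

omit [IsProbabilityMeasure μ] in
theorem ae_norm_le_norm (f : Lp ℝ ∞ μ) : ∀ᵐ x ∂μ, ‖f x‖ ≤ ‖f‖ := by
  filter_upwards [ae_le_eLpNormEssSup (f := f)] with x hx
  rw [Lp.norm_def, eLpNorm_exponent_top, ← toReal_enorm]
  exact ENNReal.toReal_mono (by simpa [eLpNorm_exponent_top] using Lp.eLpNorm_ne_top f) hx

omit [IsProbabilityMeasure μ] in
theorem exists_signal (f : Lp ℝ ∞ μ) :
    ∃ (c : ℝ) (u : Ω → ℝ) (hu : MemLp u ∞ μ), IsSignal u ∧ f = c • hu.toLp u := by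
  -- The `+ 1` keeps `c` positive when `f = 0`; the truncation in `u` is needed because `|f| ≤ ‖f‖`
  -- holds only almost everywhere.
  let c : ℝ := ‖f‖ + 1
  have hc : 0 < c := by positivity
  let u : Ω → ℝ := fun x => max (-1) (min 1 (f x / c))
  have hmeas : Measurable u :=
    measurable_const.max (measurable_const.min ((Lp.stronglyMeasurable f).measurable.div_const c))
  have hsig : IsSignal u := ⟨hmeas, fun x => ⟨le_max_left _ _, max_le (by norm_num) (min_le_left _ _)⟩⟩
  have hu : MemLp u ∞ μ := memLp_top_of_bound hmeas.aestronglyMeasurable 1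
    (ae_of_all _ fun x => abs_le.2 (hsig.mem_Icc x))
  refine ⟨c, u, hu, hsig, Lp.ext ?_⟩
  filter_upwards [ae_norm_le_norm f, Lp.coeFn_smul c (hu.toLp u), hu.coeFn_toLp]
    with x hx h1 h2
  rw [h1, Pi.smul_apply, h2, smul_eq_mul]
  have hle : |f x / c| ≤ 1 := by
    rw [abs_div, abs_of_pos hc, div_le_one hc]
    exact hx.trans (by simp [c])
  have : u x = f x / c := by
    simp only [u]
    rw [min_eq_right (abs_le.1 hle).2, max_eq_right (abs_le.1 hle).1]
  rw [this, mul_div_cancel₀ _ hc.ne']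

omit [IsProbabilityMeasure μ] in
theorem form_smul_smul (c d : ℝ) (f g : Lp ℝ ∞ μ) :
    form A (c • f) (d • g) = c * d * form A f g := by
  rw [form, form, ← integral_const_mul, map_smul]
  refine integral_congr_ae ?_
  filter_upwards [Lp.coeFn_smul c (A f), Lp.coeFn_smul d g] with x h1 h2
  rw [h1, h2, Pi.smul_apply, Pi.smul_apply, smul_eq_mul, smul_eq_mul]
  ring

omit [IsProbabilityMeasure μ] in
theorem ActsOnSignals.unique {B : POperator μ} (hA : ActsOnSignals A ν) (hB : ActsOnSignals B ν) :
    B = A := by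
  ext1 f
  obtain ⟨c, u, hu, hsig, rfl⟩ := exists_signal f
  rw [map_smul, map_smul]
  congr 1
  refine Lp.ext ?_
  filter_upwards [hA u hu hsig, hB u hu hsig] with x h1 h2
  rw [h1.2, h2.2]

omit [IsProbabilityMeasure μ] in
theorem ActsOnSignals.form_eq (h : ActsOnSignals A ν) {u v : Ω → ℝ} (hu : MemLp u ∞ μ)
    (hv : MemLp v ∞ μ) (hus : IsSignal u) :
    form A (hu.toLp u) (hv.toLp v) = ∫ x, (∫ y, u y ∂(ν x)) * v x ∂μ := by
  refine integral_congr_ae ?_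
  filter_upwards [h u hu hus, hv.coeFn_toLp] with x h1 h2
  rw [h1.2, h2]

omit [IsProbabilityMeasure μ] in
theorem ActsOnSignals.selfAdjoint (h : ActsOnSignals A ν) (hν : SymmetricFibers μ ν) :
    SelfAdjoint A := by
  intro f g
  obtain ⟨c, u, hu, hus, rfl⟩ := exists_signal f
  obtain ⟨d, v, hv, hvs, rfl⟩ := exists_signal g
  rw [form_smul_smul, form_smul_smul, h.form_eq hu hv hus, h.form_eq hv hu hvs, hν u v hus hvs,
    mul_comm c d]

omit [IsProbabilityMeasure μ] in
theorem ActsOnLinfty.positivelyPreserving (h : ActsOnLinfty A ν) (hac : μ.bind ν ≪ μ) :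
    PositivelyPreserving A := by
  intro f hf
  filter_upwards [h f (Lp.memLp f), Measure.ae_ae_of_ae_comp (hac.ae_le hf)] with x h1 h2
  rw [Lp.toLp_coeFn] at h1
  rw [h1.2]
  exact integral_nonneg_of_ae h2

omit [IsProbabilityMeasure μ] in
theorem ae_le_fiberBound (μ : Measure Ω) (ν : Kernel Ω Ω) :
    ∀ᵐ x ∂μ, ν x univ ≤ fiberBound μ ν :=
  ENNReal.ae_le_essSup _

theorem isFiniteMeasure_bind_of_fiberBound (hb : fiberBound μ ν < ∞) :
    IsFiniteMeasure (μ.bind ν) := by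
  constructor
  rw [Measure.bind_apply MeasurableSet.univ ν.aemeasurable]
  calc ∫⁻ x, ν x univ ∂μ ≤ ∫⁻ _, fiberBound μ ν ∂μ := lintegral_mono_ae (ae_le_fiberBound μ ν)
    _ = fiberBound μ ν := by simp
    _ < ∞ := hb

/-- Symmetry for `1_S` and `1` reads `∫ ν_x(S) dμ = ∫_S ν_x(Ω) dμ`, and the right side vanishes when
`μ S = 0`. -/
theorem SymmetricFibers.bind_ac (hν : SymmetricFibers μ ν) (hb : fiberBound μ ν < ∞) :
    μ.bind ν ≪ μ := by
  refine Measure.AbsolutelyContinuous.mk fun S hS h0 => ?_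
  have := isFiniteMeasure_bind_of_fiberBound hb
  have hSint : Integrable (S.indicator fun _ => (1 : ℝ)) (μ.bind ν) :=
    (integrable_const 1).indicator hS
  have h1 := hν _ _ (isSignal_indicator hS) (isSignal_indicator MeasurableSet.univ)
  have h2 : ∫ x, (∫ y, univ.indicator (fun _ => (1 : ℝ)) y ∂(ν x))
      * S.indicator (fun _ => (1 : ℝ)) x ∂μ = 0 := by
    refine integral_eq_zero_of_ae ?_
    filter_upwards [measure_eq_zero_iff_ae_notMem.1 h0] with x hx
    simp [hx]
  rw [h2] at h1
  simp only [indicator_univ, mul_one] at h1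
  rw [← integral_bind hSint, integral_indicator_const _ hS, smul_eq_mul, mul_one,
    measureReal_eq_zero_iff] at h1
  exact h1

/-- Fibers of essentially bounded mass define a P-operator, if no null set is charged. -/
theorem exists_actsOnLinfty (hb : fiberBound μ ν < ∞) (hac : μ.bind ν ≪ μ) :
    ∃ A : POperator μ, ActsOnLinfty A ν := by
  have hfin := isFiniteMeasure_bind_of_fiberBound hb
  have hint : ∀ {f : Ω → ℝ}, MemLp f ∞ μ → Integrable f (μ.bind ν) := fun hf =>
    (memLp_top_of_absolutelyContinuous hf hac).integrable le_top
  have hint' : ∀ f : Lp ℝ ∞ μ, Integrable (fun x => ∫ y, f y ∂(ν x)) μ := fun f =>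
    integrable_integral_of_bind (hint (Lp.memLp f))
  -- Identities between representatives hold `μ`-a.e.; `hac` transfers them to `ν_x`-a.e. for almost
  -- every `x`, which gives linearity.
  let L : Lp ℝ ∞ μ →ₗ[ℝ] Lp ℝ 1 μ :=
    { toFun := fun f => (hint' f).toL1 _
      map_add' := fun f g => by
        rw [← Integrable.toL1_add]
        refine (Integrable.toL1_eq_toL1_iff _ _ _ _).2 ?_
        filter_upwards [Measure.ae_integrable_of_integrable_comp (hint (Lp.memLp f)),
          Measure.ae_integrable_of_integrable_comp (hint (Lp.memLp g)),
          Measure.ae_ae_of_ae_comp (hac.ae_le (Lp.coeFn_add f g))] with x hf hg hfg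
        rw [integral_congr_ae hfg]
        exact integral_add hf hg
      map_smul' := fun c f => by
        rw [RingHom.id_apply, ← Integrable.toL1_smul]
        refine (Integrable.toL1_eq_toL1_iff _ _ _ _).2 ?_
        filter_upwards [Measure.ae_ae_of_ae_comp (hac.ae_le (Lp.coeFn_smul c f))] with x hf
        rw [integral_congr_ae hf]
        exact integral_smul c _ }
  have hL : ∀ f, L f =ᵐ[μ] fun x => ∫ y, f y ∂(ν x) := fun f => (hint' f).coeFn_toL1
  have hbound : ∀ f, ‖L f‖ ≤ (fiberBound μ ν).toReal * ‖f‖ := by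
    intro f
    have : ∀ᵐ x ∂μ, ‖L f x‖ ≤ (fiberBound μ ν).toReal * ‖f‖ := by
      filter_upwards [hL f, ae_le_fiberBound μ ν,
        Measure.ae_ae_of_ae_comp (hac.ae_le (ae_norm_le_norm f))] with x h1 h2 h3
      have : IsFiniteMeasure (ν x) := ⟨h2.trans_lt hb⟩
      rw [h1]
      refine (norm_integral_le_of_norm_le_const h3).trans ?_
      rw [mul_comm]
      exact mul_le_mul_of_nonneg_right (ENNReal.toReal_mono hb.ne h2) (norm_nonneg f)
    refine (Lp.norm_le_of_ae_bound (by positivity) this).trans_eq ?_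
    simp [measureUnivNNReal]
  refine ⟨L.mkContinuous _ hbound, fun f hf => ?_⟩
  filter_upwards [hL (hf.toLp f), Measure.ae_integrable_of_integrable_comp (hint hf),
    Measure.ae_ae_of_ae_comp (hac.ae_le hf.coeFn_toLp)] with x h1 h2 h3
  refine ⟨h2, ?_⟩
  rw [LinearMap.mkContinuous_apply, h1, integral_congr_ae h3]

end Bofop

theorem mainTheorem9 {Ω : Type*} [MeasurableSpace Ω] [StandardBorelSpace Ω]
    (μ : Measure Ω) [IsProbabilityMeasure μ] :
    -- graphops: representing measure, its disintegration, boundedness on `L^∞`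
    (∀ A : Bofop.POperator μ, Bofop.IsGraphop A →
      ∃ N : Measure (Ω × Ω), Bofop.IsRepresentingMeasure A N ∧
        (∀ N' : Measure (Ω × Ω), Bofop.IsRepresentingMeasure A N' → N' = N) ∧
        ∃ ν : Kernel Ω Ω, Bofop.IsDisintegration μ N ν ∧
          (∀ ν' : Kernel Ω Ω, Bofop.IsDisintegration μ N ν' → ∀ᵐ x ∂μ, ν' x = ν x) ∧
          Bofop.ActsOnLinfty A ν ∧
          (Bofop.opNorm ∞ ∞ A < ∞ ↔ Bofop.fiberBound μ ν < ∞) ∧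
          Bofop.opNorm ∞ ∞ A = Bofop.fiberBound μ ν ∧
          Bofop.opNorm 1 1 A = Bofop.fiberBound μ ν) ∧
    -- bofops: existence and uniqueness of the fibers, and the norm formula
    (∀ A : Bofop.POperator μ, Bofop.IsBofop A →
      ∃ ν : Kernel Ω Ω, Bofop.ActsOnSignals A ν ∧ Bofop.ActsOnLinfty A ν ∧
        (∀ ν' : Kernel Ω Ω, Bofop.ActsOnSignals A ν' → ∀ᵐ x ∂μ, ν' x = ν x) ∧
        Bofop.opNorm ∞ ∞ A = Bofop.opNorm 1 1 A ∧
        Bofop.opNorm 1 1 A = Bofop.fiberBound μ ν ∧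
        Bofop.fiberBound μ ν < ∞) ∧
    -- converse: symmetric fibers of essentially bounded mass define a bofop
    (∀ ν : Kernel Ω Ω, Bofop.fiberBound μ ν < ∞ → Bofop.SymmetricFibers μ ν →
      ∃ A : Bofop.POperator μ, Bofop.ActsOnLinfty A ν ∧
        (∀ B : Bofop.POperator μ, Bofop.ActsOnSignals B ν → B = A) ∧
        Bofop.IsBofop A ∧
        Bofop.opNorm ∞ ∞ A = Bofop.opNorm 1 1 A ∧
        Bofop.opNorm 1 1 A = Bofop.fiberBound μ ν) := by
  refine ⟨fun A hA => ?_, fun A hA => ?_, fun ν hb hν => ?_⟩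
  · have h := hA.isFiberKernel_fiberKernel
    have hN := h.isRepresentingMeasure hA
    exact ⟨_, hN, fun N' hN' => hN.unique hN', Bofop.fiberKernel A,
      Bofop.isDisintegration_jointMeasure,
      fun ν' hν' => Bofop.isDisintegration_jointMeasure.unique
        (ae_of_all _ (Bofop.fiberKernel_apply_lt_top A)) hν',
      h.actsOnLinfty hA, by rw [h.opNorm_top_eq hA], h.opNorm_top_eq hA, h.opNorm_one_eq hA⟩
  · have hG := hA.toIsGraphop
    have h := hG.isFiberKernel_fiberKernel
    refine ⟨Bofop.fiberKernel A, (h.actsOnLinfty hG).actsOnSignals, h.actsOnLinfty hG,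
      fun ν' hν' => ?_, by rw [h.opNorm_top_eq hG, h.opNorm_one_eq hG], h.opNorm_one_eq hG,
      by rw [← h.opNorm_one_eq hG]; exact hA.norm_lt_top⟩
    refine Bofop.ae_eq_of_forall_measurableSet
      (ae_of_all _ (Bofop.fiberKernel_apply_lt_top A)) fun S hS => ?_
    filter_upwards [hν'.ae_apply hS, h.ae_apply hG hS] with x h1 h2
    rw [h1, h2]
  · have hac := hν.bind_ac hb
    obtain ⟨A, hA⟩ := Bofop.exists_actsOnLinfty hb hac
    have hG : Bofop.IsGraphop A :=
      ⟨hA.actsOnSignals.selfAdjoint hν, hA.positivelyPreserving hac⟩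
    have h := hA.actsOnSignals.isFiberKernel hG
    exact ⟨A, hA, fun B hB => hA.actsOnSignals.unique hB,
      ⟨hG, by rw [h.opNorm_one_eq hG]; exact hb⟩,
      by rw [h.opNorm_top_eq hG, h.opNorm_one_eq hG], h.opNorm_one_eq hG⟩
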